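/- Let $H$ be a finite Heyting algebra, and let $X_H$ be its dual finite poset: the set of prime filters of $H$ ordered by inclusion, regarded as a category. Let $\mathbf{S}$ be the category of Stone spaces (compact Hausdorff zero-dimensional spaces) and continuous maps, and let $\mathbf{S}^{X_H}$ be the category of functors $F\colon X_H\to\mathbf{S}$ (for $x\le y$ write $F_{xy}\colon F(x)\to F(y)$) and natural transformations. An $H$-algebra is a Heyting algebra $A$ with a Heyting homomorphism $H\to A$; morphisms of $H$-algebras are the Heyting homomorphisms compatible with the maps from $H$. An $H$-algebra is called étale if it belongs to the variety generated by the identity $H\to H$, i.e. to the smallest class of $H$-algebras containing $H$ and closed under products, subalgebras and homomorphic images; étale $H$-algebras form a full subcategory of the category of $H$-algebras. For $F\in\mathbf{S}^{X_H}$ let $\int F=\coprod_{x\in X_H}F(x)$ with the disjoint union topology and the order $(x,\xi)\le(y,\eta)$ iff $x\le y$ and $F_{xy}(\xi)=\eta$; this is an Esakia space, and the projection $\pi\colon\int F\to X_H$ is a continuous $p$-morphism. The Esakia dual $H(F)$ of $\pi$ is the Heyting algebra of clopen upsets of $\int F$, regarded as an $H$-algebra by $h\mapsto\{(x,\xi)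 : h\in x\}$. For $x\in X_H$ let $\mathrm{Up}({\uparrow}x)$ be the Heyting algebra of upsets of ${\uparrow}x=\{y\in X_H: x\le y\}$, regarded as an $H$-algebra by $h\mapsto\{y\ge x : h\in y\}$. Then: 1. The category $\mathbf{S}^{X_H}$ is dually equivalent to the category of étale $H$-algebras; more precisely, the contravariant functor that sends $F$ to $H(F)$, and a natural transformation $F\to G$ to the inverse image homomorphism $H(G)\to H(F)$ along the induced map $\int F\to\int G$, gives such a dual equivalence. 2. For every $F\in\mathbf{S}^{X_H}$ there is an injective homomorphism of $H$-algebras $H(F)\to\prod_{x\in X_H,\ \xi\in F(x)}\mathrm{Up}({\uparrow}x)$. 3. For every $x\in X_H$, the $H$-algebra $\mathrm{Up}({\uparrow}x)$ is a homomorphic image of $H$. -/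

import Mathlib

open CategoryTheory Opposite TopologicalSpace

universe u

namespace EtaleHeyting

/-! ### Esakia spaces and the Heyting algebra of clopen upsets -/

section EsakiaSpaces

/-- An Esakia space: a compact ordered space satisfying the Priestley separation axiom in which the
downset generated by a clopen set is clopen. -/
class EsakiaSpace (α : Type*) [TopologicalSpace α] [PartialOrder α] : Prop
    extends CompactSpace α, PriestleySpace α where
  isClopen_lowerClosure : ∀ C : Set α, IsClopen C → IsClopen (lowerClosure C : Set α)

variable {α β γ : Type*} [TopologicalSpace α] [PartialOrder α]
  [TopologicalSpace β] [PartialOrder β] [TopologicalSpace γ] [PartialOrder γ]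

/-- A finite poset with the discrete topology is an Esakia space; all of its upsets are clopen. -/
instance [Finite α] [DiscreteTopology α] : EsakiaSpace α where
  priestley {x _} h := ⟨Set.Ici x, isClopen_discrete _, isUpperSet_Ici x, le_refl x, h⟩
  isClopen_lowerClosure _ _ := isClopen_discrete _

/-- The implication of clopen upsets: `U ⇨ V` is the complement of the downset generated by
`U \ V`, which is the largest clopen upset `W` with `W ∩ U ⊆ V`. -/
def himp [EsakiaSpace α] (U V : ClopenUpperSet α) : ClopenUpperSet α where
  carrier := (lowerClosure ((U : Set α) \ V) : Set α)ᶜ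
  isClopen' := (EsakiaSpace.isClopen_lowerClosure _ (U.isClopen.diff V.isClopen)).compl
  upper' := (lowerClosure ((U : Set α) \ V)).lower.compl

theorem mem_himp [EsakiaSpace α] {U V : ClopenUpperSet α} {x : α} :
    x ∈ himp U V ↔ ∀ y, x ≤ y → y ∈ U → y ∈ V := by
  change x ∉ lowerClosure ((U : Set α) \ V) ↔ _
  simp only [mem_lowerClosure, not_exists, not_and, Set.mem_sdiff, SetLike.mem_coe]
  constructor
  · intro h y hxy hU
    by_contra hV
    exact h y ⟨hU, hV⟩ hxy
  · intro h y hy hxy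
    exact hy.2 (h y hxy hy.1)

/-- The Heyting algebra of clopen upsets of an Esakia space, ordered by inclusion. -/
instance [EsakiaSpace α] : HeytingAlgebra (ClopenUpperSet α) where
  le_top _ := le_top
  bot_le _ := bot_le
  himp := himp
  le_himp_iff U V W := by
    constructor
    · intro h x hx
      exact mem_himp.1 (h hx.1) x le_rfl hx.2
    · intro h x hx
      exact mem_himp.2 fun y hxy hy => h ⟨U.upper hxy hx, hy⟩
  compl U := himp U ⊥
  himp_bot _ := rfl

/-- The Esakia dual of a continuous `p`-morphism: inverse image of clopen upsets. -/
def dualHom [EsakiaSpace α] [EsakiaSpace β] (f : EsakiaHom α β) :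
    HeytingHom (ClopenUpperSet β) (ClopenUpperSet α) where
  toFun U :=
    { carrier := f ⁻¹' U
      isClopen' := U.isClopen.preimage f.continuous_toFun
      upper' := fun _ _ hab ha => U.upper (f.monotone' hab) ha }
  map_sup' _ _ := rfl
  map_inf' _ _ := rfl
  map_bot' := rfl
  map_himp' U V := by
    refine SetLike.ext fun x => ?_
    change f x ∈ himp U V ↔ x ∈ himp _ _
    rw [mem_himp, mem_himp]
    constructor
    · intro h y hxy hy
      exact h (f y) (f.monotone' hxy) hy
    · intro h z hz hzU
      obtain ⟨y, hxy, rfl⟩ := f.exists_map_eq_of_map_le' hz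
      exact h y hxy hzU

/-- The inclusion of a principal upset, as a continuous `p`-morphism. -/
def iciIncl (x : α) : EsakiaHom (Set.Ici x) α where
  toFun := Subtype.val
  monotone' _ _ h := h
  continuous_toFun := continuous_subtype_val
  exists_map_eq_of_map_le' a b h := ⟨⟨b, le_trans a.2 h⟩, h, rfl⟩

end EsakiaSpaces

/-! ### The Esakia dual of a Heyting algebra -/

section Dual

/-- The dual `X_H` of `H`: prime filters of `H`, ordered by inclusion. -/
def EsakiaDual (H : Type u) [HeytingAlgebra H] : Type u :=
  { x : Order.PFilter H // x.IsPrime }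

variable {H : Type u} [HeytingAlgebra H]

instance : PartialOrder (EsakiaDual H) :=
  inferInstanceAs (PartialOrder { x : Order.PFilter H // x.IsPrime })

/-- The topology on `X_H` generated by the sets `{x | a ∈ x}` and their complements. -/
instance : TopologicalSpace (EsakiaDual H) :=
  generateFrom { S | ∃ a : H, S = { x | a ∈ x.1 } ∨ S = { x | a ∈ x.1 }ᶜ }

instance [Finite H] : Finite (EsakiaDual H) :=
  Finite.of_injective (fun x : EsakiaDual H => (x.1 : Set H))
    fun _ _ h => Subtype.ext (SetLike.coe_injective h)

theorem isClopen_mem (a : H) : IsClopen { x : EsakiaDual H | a ∈ x.1 } :=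
  ⟨⟨isOpen_generateFrom_of_mem ⟨a, Or.inr rfl⟩⟩, isOpen_generateFrom_of_mem ⟨a, Or.inl rfl⟩⟩

instance [Finite H] : DiscreteTopology (EsakiaDual H) := by
  refine discreteTopology_iff_isOpen_singleton.2 fun x => ?_
  have : ({x} : Set (EsakiaDual H)) = ⋂ a : H, { y | a ∈ y.1 ↔ a ∈ x.1 } := by
    ext y
    simp only [Set.mem_singleton_iff, Set.mem_iInter, Set.mem_ofPred_eq]
    exact ⟨fun h a => h ▸ Iff.rfl, fun h => Subtype.ext (SetLike.ext h)⟩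
  rw [this]
  refine isOpen_iInter_of_finite fun a => ?_
  by_cases ha : a ∈ x.1
  · simpa only [ha, iff_true] using (isClopen_mem a).isOpen
  · simp only [ha, iff_false]
    exact (isClopen_mem a).compl.isOpen

theorem EsakiaDual.bot_notMem (x : EsakiaDual H) : ⊥ ∉ x.1 := by
  intro h
  obtain ⟨a, ha⟩ := x.2.compl_ideal.toIdeal.nonempty
  exact ha (Order.PFilter.mem_of_le bot_le h)

theorem EsakiaDual.sup_mem_iff (x : EsakiaDual H) {a b : H} : a ⊔ b ∈ x.1 ↔ a ∈ x.1 ∨ b ∈ x.1 := by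
  constructor
  · intro h
    by_contra hab
    rw [not_or] at hab
    exact (Order.Ideal.sup_mem (s := x.2.compl_ideal.toIdeal) hab.1 hab.2) h
  · rintro (h | h)
    · exact Order.PFilter.mem_of_le le_sup_left h
    · exact Order.PFilter.mem_of_le le_sup_right h

theorem EsakiaDual.himp_mem_iff (x : EsakiaDual H) {a b : H} :
    a ⇨ b ∈ x.1 ↔ ∀ y : EsakiaDual H, x ≤ y → a ∈ y.1 → b ∈ y.1 := by
  constructor
  · intro h y hxy ha
    exact Order.PFilter.mem_of_le himp_inf_le (Order.PFilter.inf_mem (hxy h) ha)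
  · intro h
    by_contra hab
    have hF : Order.IsPFilter { c : H | a ⇨ c ∈ x.1 } := by
      refine Order.IsPFilter.of_def ⟨⊤, ?_⟩ ?_ ?_
      · simp
      · intro c hc d hd
        refine ⟨c ⊓ d, ?_, inf_le_left, inf_le_right⟩
        simp only [Set.mem_ofPred_eq] at hc hd ⊢
        rw [himp_inf_distrib]
        exact Order.PFilter.inf_mem hc hd
      · intro c d hcd hc
        exact Order.PFilter.mem_of_le (himp_le_himp_left hcd) hc
    have hdisj : Disjoint (hF.toPFilter : Set H) (Order.Ideal.principal b : Set H) := by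
      refine Set.disjoint_left.2 fun c hc hcb => hab ?_
      exact Order.PFilter.mem_of_le (himp_le_himp_left hcb) hc
    obtain ⟨J, hJ, hbJ, hFJ⟩ := DistribLattice.prime_ideal_of_disjoint_filter_ideal hdisj
    have hmem : ∀ {c}, c ∈ hJ.toPrimePair.F ↔ c ∉ J := Iff.rfl
    have hFmem : ∀ {c}, a ⇨ c ∈ x.1 → c ∈ hJ.toPrimePair.F := fun hc =>
      hmem.2 (Set.disjoint_left.1 hFJ hc)
    refine hmem.1 (h ⟨hJ.toPrimePair.F, hJ.toPrimePair.F_isPrime⟩ ?_ ?_)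
      (hbJ (Order.Ideal.mem_principal.2 le_rfl))
    · exact fun c hc => hFmem (Order.PFilter.mem_of_le le_himp hc)
    · exact hFmem (by simp)

/-- The representation homomorphism from `H` to the clopen upsets of `X_H`,
sending `a` to the set of prime filters containing `a`. -/
def reprHom (H : Type u) [HeytingAlgebra H] [Finite H] :
    HeytingHom H (ClopenUpperSet (EsakiaDual H)) where
  toFun a :=
    { carrier := { x | a ∈ x.1 }
      isClopen' := isClopen_mem a
      upper' := fun _ _ hxy hx => hxy hx }
  map_sup' a b := SetLike.ext fun x => x.sup_mem_iff
  map_inf' a b := SetLike.ext fun x => Order.PFilter.inf_mem_iff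
  map_bot' := SetLike.ext fun x => iff_of_false x.bot_notMem id
  map_himp' a b := SetLike.ext fun x => by
    refine x.himp_mem_iff.trans (Iff.symm ?_)
    exact mem_himp

end Dual

/-! ### The Grothendieck construction of a Stone space valued copresheaf -/

section Grothendieck

variable {X : Type u} [PartialOrder X]

/-- The points of the total space `∫ F`: pairs of `x : X` and `ξ ∈ F(x)`. -/
def Total (F : X ⥤ Profinite.{u}) : Type u := Σ x : X, F.obj x

/-- The topology of the disjoint union of the spaces `F(x)`. -/
instance (F : X ⥤ Profinite.{u}) : TopologicalSpace (Total F) :=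
  inferInstanceAs (TopologicalSpace (Σ x : X, F.obj x))

/-- `(x, ξ) ≤ (y, η)` iff `x ≤ y` and the transition map `F(x) → F(y)` sends `ξ` to `η`. -/
instance (F : X ⥤ Profinite.{u}) : PartialOrder (Total F) where
  le p q := ∃ h : p.1 ≤ q.1, F.map (homOfLE h) p.2 = q.2
  le_refl p := ⟨le_rfl, by
    have : homOfLE (le_refl p.1) = 𝟙 p.1 := rfl
    rw [this, F.map_id]; rfl⟩
  le_trans := by
    rintro p q r ⟨h, e⟩ ⟨h', e'⟩
    refine ⟨h.trans h', ?_⟩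
    rw [← homOfLE_comp h h', F.map_comp, ← e', ← e]
    rfl
  le_antisymm := by
    rintro ⟨x, ξ⟩ ⟨y, η⟩ ⟨h, e⟩ ⟨h', e'⟩
    obtain rfl : x = y := le_antisymm h h'
    have : homOfLE h = 𝟙 x := rfl
    rw [this, F.map_id] at e
    exact congrArg (Sigma.mk x) e

theorem Total.le_def {F : X ⥤ Profinite.{u}} {p q : Total F} :
    p ≤ q ↔ ∃ h : p.1 ≤ q.1, F.map (homOfLE h) p.2 = q.2 := Iff.rfl

theorem Total.map_map (F : X ⥤ Profinite.{u}) {x y z : X} (h : x ≤ y) (h' : y ≤ z)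
    (ξ : F.obj x) :
    F.map (homOfLE h') (F.map (homOfLE h) ξ) = F.map (homOfLE (h.trans h')) ξ := by
  rw [← homOfLE_comp h h', F.map_comp]
  rfl

theorem Total.isClopen_iff {F : X ⥤ Profinite.{u}} {C : Set (Total F)} :
    IsClopen C ↔ ∀ x : X, IsClopen { ξ : F.obj x | (⟨x, ξ⟩ : Total F) ∈ C } := by
  constructor
  · intro h x
    exact h.preimage (f := fun ξ : F.obj x => (⟨x, ξ⟩ : Total F))
      (continuous_sigmaMk (σ := fun x : X => F.obj x))
  · intro h
    exact ⟨(isClosed_sigma_iff (σ := fun x : X => F.obj x)).2 fun x => (h x).1,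
      (isOpen_sigma_iff (σ := fun x : X => F.obj x)).2 fun x => (h x).2⟩

instance [Finite X] (F : X ⥤ Profinite.{u}) : EsakiaSpace (Total F) where
  toCompactSpace := inferInstanceAs (CompactSpace (Σ x : X, F.obj x))
  priestley := by
    rintro ⟨x, ξ⟩ ⟨y, η⟩ hle
    obtain ⟨C, hC, hηC, hξC⟩ : ∃ C : Set (F.obj y), IsClopen C ∧ η ∉ C ∧
        ∀ h : x ≤ y, F.map (homOfLE h) ξ ∈ C := by
      by_cases h : x ≤ y
      · have hne : F.map (homOfLE h) ξ ≠ η := fun e => hle ⟨h, e⟩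
        obtain ⟨C, hC, h1, h2⟩ := exists_isClopen_of_totally_separated hne
        exact ⟨C, hC, h2, fun _ => h1⟩
      · exact ⟨∅, isClopen_empty, id, fun h' => (h h').elim⟩
    refine ⟨{ p : Total F | x ≤ p.1 ∧ ∀ h : p.1 ≤ y, F.map (homOfLE h) p.2 ∈ C }, ?_, ?_, ?_, ?_⟩
    · refine Total.isClopen_iff.2 fun z => ?_
      by_cases hxz : x ≤ z
      · by_cases hzy : z ≤ y
        · have := hC.preimage (F.map (homOfLE hzy)).hom.hom.continuous
          convert this using 1
          ext ζ
          exact ⟨fun h => h.2 hzy, fun h => ⟨hxz, fun _ => h⟩⟩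
        · convert isClopen_univ using 1
          ext ζ
          exact ⟨fun _ => trivial, fun _ => ⟨hxz, fun h => (hzy h).elim⟩⟩
      · convert isClopen_empty using 1
        ext ζ
        exact ⟨fun h => hxz h.1, fun h => h.elim⟩
    · rintro p q ⟨hpq, e⟩ ⟨hx, hp⟩
      refine ⟨hx.trans hpq, fun h => ?_⟩
      rw [← e, Total.map_map]
      exact hp _
    · exact ⟨le_rfl, hξC⟩
    · rintro ⟨_, h⟩
      have := h le_rfl
      have e : homOfLE (le_refl y) = 𝟙 y := rfl
      rw [e, F.map_id] at this
      exact hηC this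
  isClopen_lowerClosure C hC := by
    refine Total.isClopen_iff.2 fun x => ?_
    have key : { ξ : F.obj x | (⟨x, ξ⟩ : Total F) ∈ (lowerClosure C : Set (Total F)) } =
        ⋃ y : Set.Ici x, (F.map (homOfLE y.2)) ⁻¹' { η | (⟨y.1, η⟩ : Total F) ∈ C } := by
      ext ξ
      rw [Set.mem_iUnion]
      constructor
      · rintro ⟨⟨y, η⟩, hy, h, e⟩
        refine ⟨⟨y, h⟩, ?_⟩
        change F.map (homOfLE h) ξ = η at e
        change (⟨y, F.map (homOfLE h) ξ⟩ : Total F) ∈ C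
        rw [e]
        exact hy
      · rintro ⟨y, hy⟩
        exact ⟨_, hy, y.2, rfl⟩
    rw [key]
    exact isClopen_iUnion_of_finite fun y =>
      (Total.isClopen_iff.1 hC y.1).preimage (F.map (homOfLE y.2)).hom.hom.continuous

/-- The projection `π : ∫ F → X`, a continuous `p`-morphism. -/
def proj [TopologicalSpace X] (F : X ⥤ Profinite.{u}) :
    EsakiaHom (Total F) X where
  toFun p := p.1
  monotone' _ _ h := h.1
  continuous_toFun := continuous_sigma (σ := fun x : X => F.obj x) fun _ => continuous_const
  exists_map_eq_of_map_le' p y h := ⟨⟨y, F.map (homOfLE h) p.2⟩, ⟨h, rfl⟩, rfl⟩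

/-- The map `∫ F → ∫ G` induced by a natural transformation `F ⟶ G`. -/
def totalMap {F G : X ⥤ Profinite.{u}} (γ : F ⟶ G) : EsakiaHom (Total F) (Total G) where
  toFun p := ⟨p.1, γ.app p.1 p.2⟩
  monotone' := by
    rintro p q ⟨h, e⟩
    refine ⟨h, ?_⟩
    change G.map (homOfLE h) (γ.app p.1 p.2) = γ.app q.1 q.2
    rw [← e]
    exact (NatTrans.naturality_apply γ (homOfLE h) p.2).symm
  continuous_toFun := continuous_sigma (σ := fun x : X => F.obj x) fun x =>
    (continuous_sigmaMk (σ := fun x : X => G.obj x)).comp (γ.app x).hom.hom.continuous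
  exists_map_eq_of_map_le' := by
    rintro p ⟨y, η⟩ ⟨h, e⟩
    refine ⟨⟨y, F.map (homOfLE h) p.2⟩, ⟨h, rfl⟩, ?_⟩
    refine congrArg (Sigma.mk y) ?_
    refine Eq.trans ?_ e
    exact NatTrans.naturality_apply γ (homOfLE h) p.2

end Grothendieck

/-! ### `H`-algebras and étale `H`-algebras -/

section Algebras

variable (H : Type u) [HeytingAlgebra H]

/-- The category of `H`-algebras: objects are Heyting homomorphisms `H → A`, morphisms are
Heyting homomorphisms under `H`. Equivalently, Heyting algebras with a constant for each element
of `H`, subject to the variable-free identities that hold in `H`. -/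
abbrev HAlg : Type (u + 1) := Under (HeytAlg.of H)

variable {H}

/-- The `H`-algebra given by a Heyting homomorphism. -/
abbrev HAlg.of {A : Type u} [HeytingAlgebra A] (c : HeytingHom H A) : HAlg H :=
  Under.mk (HeytAlg.ofHom c)

/-- The product of a family of `H`-algebras, with pointwise operations. -/
abbrev HAlg.pi {ι : Type u} (A : ι → HAlg H) : HAlg H :=
  HAlg.of (A := ∀ i, (A i).right)
    { toFun := fun h i => (A i).hom h
      map_sup' := fun a b => funext fun i => map_sup (A i).hom.hom a b
      map_inf' := fun a b => funext fun i => map_inf (A i).hom.hom a b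
      map_bot' := funext fun i => map_bot (A i).hom.hom
      map_himp' := fun a b => funext fun i => map_himp (A i).hom.hom a b }

/-- Membership in the variety generated by `H`, regarded as an `H`-algebra by its identity map: the
smallest class of `H`-algebras containing `H` and closed under products, subalgebras and
homomorphic images. -/
inductive IsEtale : ObjectProperty (HAlg H)
  | base : IsEtale (HAlg.of (HeytingHom.id H))
  | prod {ι : Type u} (A : ι → HAlg H) (hA : ∀ i, IsEtale (A i)) : IsEtale (HAlg.pi A)
  | sub {A B : HAlg H} (f : A ⟶ B) (hf : Function.Injective f.right) (hB : IsEtale B) : IsEtale A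
  | image {A B : HAlg H} (f : A ⟶ B) (hf : Function.Surjective f.right) (hA : IsEtale A) :
      IsEtale B

variable (H) in
/-- The category of étale `H`-algebras and all `H`-algebra homomorphisms between them. -/
abbrev EtaleAlg : Type (u + 1) := (IsEtale (H := H)).FullSubcategory

variable [Finite H]

/-- The `H`-algebra `Up(↑x)` of upsets of the principal upset `↑x` of `X_H` (every upset of `↑x` is
clopen, as `X_H` is finite and discrete), where `h ∈ H` is interpreted as `{y ≥ x | h ∈ y}`. -/
def upIci (x : EsakiaDual H) : HAlg H :=
  HAlg.of ((dualHom (iciIncl x)).comp (reprHom H))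

variable (H) in
/-- The functor sending a copresheaf `F` to the Esakia dual of the projection `∫ F → X_H`,
which is the `H`-algebra of clopen upsets of `∫ F`. -/
def dualFunctor : (EsakiaDual H ⥤ Profinite.{u})ᵒᵖ ⥤ HAlg H where
  obj F := HAlg.of ((dualHom (proj F.unop)).comp (reprHom H))
  map γ := Under.homMk (HeytAlg.ofHom (dualHom (totalMap γ.unop))) rfl
  map_id _ := rfl
  map_comp _ _ := rfl

end Algebras

end EtaleHeyting

open EtaleHeyting

/-! Since `H` is finite, every upset of `X_H` is given by an element of `H`; hence `H` maps onto
each `Up(↑x)`. The transition maps carry `↑x` onto the principal upset of a point `(x, ξ)` of `∫ F`,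
and pulling back along all these maps embeds `H(F)` into the product of the `Up(↑x)`. So `H(F)` is
étale.

Full faithfulness is Esakia duality over `X_H`: by compactness (`exists_forall_mem_iff`) an
`H`-algebra map induces a map of points over `X_H`, continuous on fibres, whose monotonicity is
naturality (`exists_dualHom_totalMap_eq`).

Essential surjectivity needs that a prime filter of an étale `A` over `x` lies below exactly one
prime filter over each `y ≥ x`. If `a` and `b` represent `↑y` and the complement of `↓y`, only `y`
contains `a` but not `b`. Uniqueness therefore becomes the identity `IsFiberwiseSplit`, which holds
in `H` and passes to the whole variety. It also makes `u ↦ (c a ⇨ c b ⊔ u)` pull prime filters over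
`x` back to prime filters over `y` (`Fiber.exists_le`). The fibres thus form a copresheaf, and
compactness (`surjective_of_separates`) identifies `A` with its clopen upsets. -/

open EtaleHeyting

namespace EtaleHeyting

/-! ### Prime filters, and upsets of the dual of a finite algebra -/

section PrimeFilters

variable {H A : Type u} [HeytingAlgebra H] [HeytingAlgebra A]

theorem EsakiaDual.ext_mem {x y : EsakiaDual H} (h : ∀ a, a ∈ x.1 ↔ a ∈ y.1) : x = y :=
  Subtype.ext (SetLike.ext h)

theorem EsakiaDual.exists_mem_notMem {a b : H} (hab : ¬ a ≤ b) :
    ∃ x : EsakiaDual H, a ∈ x.1 ∧ b ∉ x.1 := by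
  have hdisj : Disjoint (Order.PFilter.principal a : Set H) (Order.Ideal.principal b : Set H) := by
    refine Set.disjoint_left.2 fun c hc hcb => hab ?_
    exact le_trans (Order.PFilter.mem_principal.1 hc) (Order.Ideal.mem_principal.1 hcb)
  obtain ⟨J, hJ, hbJ, hFJ⟩ := DistribLattice.prime_ideal_of_disjoint_filter_ideal hdisj
  refine ⟨⟨hJ.toPrimePair.F, hJ.toPrimePair.F_isPrime⟩, ?_, ?_⟩
  · exact Set.disjoint_left.1 hFJ (Order.PFilter.mem_principal.2 le_rfl)
  · exact fun h => h (hbJ (Order.Ideal.mem_principal.2 le_rfl))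

theorem EsakiaDual.le_iff_forall_mem {a b : H} :
    a ≤ b ↔ ∀ x : EsakiaDual H, a ∈ x.1 → b ∈ x.1 := by
  refine ⟨fun h x hx => Order.PFilter.mem_of_le h hx, fun h => ?_⟩
  by_contra hab
  obtain ⟨x, ha, hb⟩ := EsakiaDual.exists_mem_notMem hab
  exact hb (h x ha)

/-- The prime filter with a given membership predicate. -/
def EsakiaDual.mk (p : H → Prop) (hinf : ∀ a b, p (a ⊓ b) ↔ p a ∧ p b)
    (hsup : ∀ a b, p (a ⊔ b) → p a ∨ p b) (htop : p ⊤) (hbot : ¬ p ⊥) : EsakiaDual H :=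
  have hle : ∀ {a b : H}, a ≤ b → p a → p b := fun {a b} hab ha => by
    rw [← inf_eq_left.2 hab] at ha
    exact ((hinf a b).1 ha).2
  have hF : Order.IsPFilter {a | p a} := Order.IsPFilter.of_def ⟨⊤, htop⟩
    (fun a ha b hb => ⟨a ⊓ b, (hinf a b).2 ⟨ha, hb⟩, inf_le_left, inf_le_right⟩) hle
  ⟨hF.toPFilter, ⟨⟨fun _ _ hba ha hb => ha (hle hba hb), ⟨⊥, hbot⟩,
    fun a ha b hb => ⟨a ⊔ b, fun h => (hsup a b h).elim ha hb, le_sup_left, le_sup_right⟩⟩⟩⟩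

theorem EsakiaDual.finsetInf_mem_iff (x : EsakiaDual H) (t : Finset H) :
    t.inf id ∈ x.1 ↔ ∀ a ∈ t, a ∈ x.1 := by
  refine ⟨fun h a ha => Order.PFilter.mem_of_le (Finset.inf_le ha) h, fun h => ?_⟩
  exact Finset.inf_induction (p := fun a => a ∈ x.1) Order.PFilter.top_mem
    (fun _ ha _ hb => Order.PFilter.inf_mem ha hb) h

theorem EsakiaDual.finsetSup_mem_iff (x : EsakiaDual H) (t : Finset H) :
    t.sup id ∈ x.1 ↔ ∃ a ∈ t, a ∈ x.1 := by
  refine ⟨fun h => ?_, fun ⟨a, ha, hx⟩ => Order.PFilter.mem_of_le (Finset.le_sup (f := id) ha) hx⟩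
  by_contra! hne
  exact Finset.sup_induction (p := fun a => a ∉ x.1) x.bot_notMem
    (fun _ ha _ hb hab => (x.sup_mem_iff.1 hab).elim ha hb) hne h

variable [Finite H]

theorem EsakiaDual.exists_mem_iff_le (x : EsakiaDual H) : ∃ a : H, ∀ y, a ∈ y.1 ↔ x ≤ y := by
  -- By finiteness `x` is principal, generated by the meet of its elements.
  refine ⟨(Set.toFinite {a | a ∈ x.1}).toFinset.inf id, fun y => ?_⟩
  rw [EsakiaDual.finsetInf_mem_iff]
  simp only [Set.Finite.mem_toFinset]
  exact Iff.rfl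

/-- Every upset of the dual of a finite Heyting algebra is represented by an element. -/
theorem EsakiaDual.exists_mem_iff_of_isUpperSet {U : Set (EsakiaDual H)} (hU : IsUpperSet U) :
    ∃ a : H, ∀ y : EsakiaDual H, a ∈ y.1 ↔ y ∈ U := by
  choose g hg using EsakiaDual.exists_mem_iff_le (H := H)
  -- `U` is a finite union of principal upsets, so the join of their generators represents it.
  refine ⟨(Set.toFinite (g '' U)).toFinset.sup id, fun y => ?_⟩
  rw [EsakiaDual.finsetSup_mem_iff]
  simp only [Set.Finite.mem_toFinset]
  constructor
  · rintro ⟨_, ⟨x, hx, rfl⟩, h⟩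
    exact hU ((hg x y).1 h) hx
  · exact fun hy => ⟨g y, ⟨y, hy, rfl⟩, (hg y y).2 le_rfl⟩

theorem EsakiaDual.exists_mem_iff_not_le (x : EsakiaDual H) :
    ∃ a : H, ∀ y, a ∈ y.1 ↔ ¬ y ≤ x :=
  EsakiaDual.exists_mem_iff_of_isUpperSet (U := {y | ¬ y ≤ x})
    fun _ _ hyz hy hz => hy (hyz.trans hz)

/-- `Up(↑x)` is a homomorphic image of `H`. -/
theorem exists_surjective_upIci (x : EsakiaDual H) :
    ∃ q : HAlg.of (HeytingHom.id H) ⟶ upIci x, Function.Surjective q.right := by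
  suffices h : Function.Surjective ((dualHom (iciIncl x)).comp (reprHom H)) from
    ⟨Under.homMk (HeytAlg.ofHom ((dualHom (iciIncl x)).comp (reprHom H))) rfl, h⟩
  intro V
  obtain ⟨a, ha⟩ := EsakiaDual.exists_mem_iff_of_isUpperSet
    (U := Subtype.val '' (V : Set (Set.Ici x))) (by
      rintro _ z hyz ⟨y, hy, rfl⟩
      exact ⟨⟨z, le_trans y.2 hyz⟩, V.upper (a := y) hyz hy, rfl⟩)
  exact ⟨a, SetLike.ext fun y => (ha y.1).trans Subtype.val_injective.mem_set_image⟩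

end PrimeFilters

/-! ### Embedding `H(F)` into a product of principal pieces -/

section Points

variable {H : Type u} [HeytingAlgebra H] [Finite H]

/-- The continuous `p`-morphism `↑x → ∫ F` whose image is the principal upset of `(x, ξ)`. -/
def Total.orbitMap {F : EsakiaDual H ⥤ Profinite.{u}} (p : Total F) :
    EsakiaHom (Set.Ici p.1) (Total F) where
  toFun y := ⟨y.1, F.map (homOfLE y.2) p.2⟩
  monotone' y z h := ⟨h, Total.map_map F y.2 h p.2⟩
  continuous_toFun := continuous_of_discreteTopology
  exists_map_eq_of_map_le' := by
    rintro y ⟨z, ζ⟩ ⟨h, e⟩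
    exact ⟨⟨z, le_trans y.2 h⟩, h,
      congrArg (Sigma.mk z) ((Total.map_map F y.2 h p.2).symm.trans e)⟩

theorem Total.orbitMap_self {F : EsakiaDual H ⥤ Profinite.{u}} (p : Total F) :
    Total.orbitMap p ⟨p.1, le_refl p.1⟩ = p := by
  refine congrArg (Sigma.mk p.1) ?_
  have : homOfLE (le_refl p.1) = 𝟙 p.1 := rfl
  change F.map (homOfLE (le_refl p.1)) p.2 = p.2
  rw [this, F.map_id]
  rfl

/-- Each point `p` is the image of the least element of `↑p.1` under its orbit map, so the orbit
maps jointly cover `∫ F` and their inverse images determine a clopen upset. -/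
theorem exists_injective_dualFunctor (F : EsakiaDual H ⥤ Profinite.{u}) :
    ∃ m : (dualFunctor H).obj (op F) ⟶ HAlg.pi fun p : Total F => upIci p.1,
      Function.Injective m.right := by
  let φ : HeytingHom (ClopenUpperSet (Total F))
      (∀ p : Total F, ClopenUpperSet (Set.Ici p.1)) :=
    { toFun := fun U p => dualHom (Total.orbitMap p) U
      map_sup' := fun _ _ => rfl
      map_inf' := fun _ _ => rfl
      map_bot' := rfl
      map_himp' := fun U V => funext fun p => map_himp (dualHom (Total.orbitMap p)) U V }
  suffices h : Function.Injective φ from ⟨Under.homMk (HeytAlg.ofHom φ) rfl, h⟩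
  intro U V hUV
  refine SetLike.ext fun p => ?_
  have h := SetLike.ext_iff.1 (congrFun hUV p) ⟨p.1, le_refl p.1⟩
  change Total.orbitMap p ⟨p.1, le_refl p.1⟩ ∈ U ↔ Total.orbitMap p ⟨p.1, le_refl p.1⟩ ∈ V at h
  rwa [Total.orbitMap_self] at h

theorem isEtale_upIci (x : EsakiaDual H) : IsEtale (upIci x) :=
  let ⟨q, hq⟩ := exists_surjective_upIci x
  IsEtale.image q hq IsEtale.base

theorem isEtale_dualFunctor (F : (EsakiaDual H ⥤ Profinite.{u})ᵒᵖ) :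
    IsEtale ((dualFunctor H).obj F) :=
  let ⟨m, hm⟩ := exists_injective_dualFunctor F.unop
  IsEtale.sub m hm (IsEtale.prod _ fun p => isEtale_upIci p.1)

end Points

/-! ### Compactness arguments in Esakia spaces -/

section Compactness

variable {Y : Type u} [TopologicalSpace Y] [PartialOrder Y] [EsakiaSpace Y]

/-- Every prime filter of clopen upsets is the set of clopen upsets containing some point. -/
theorem exists_forall_mem_iff (P : ClopenUpperSet Y → Prop)
    (hinf : ∀ U V, P U → P V → P (U ⊓ V)) (hsup : ∀ U V, P (U ⊔ V) → P U ∨ P V)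
    (hmono : ∀ U V, U ≤ V → P U → P V) (htop : P ⊤) (hbot : ¬ P ⊥) :
    ∃ y : Y, ∀ U : ClopenUpperSet Y, y ∈ U ↔ P U := by
  classical
  by_contra! hne
  -- If no point works, the clopen sets on which `y ∈ U` and `P U` disagree cover `Y`. For a finite
  -- subcover, the meet of the members satisfying `P` lies below the join of the others,
  -- contradicting primeness.
  obtain ⟨t, ht⟩ := isCompact_univ.elim_finite_subcover
    (fun U : ClopenUpperSet Y => {y | ¬ (y ∈ U ↔ P U)}) (fun U => by
      by_cases hU : P U
      · simp only [hU, iff_true]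
        exact U.isClopen.compl.isOpen
      · simp only [hU, iff_false, not_not]
        exact U.isClopen.isOpen)
    (fun y _ => by
      obtain ⟨U, hU⟩ := hne y
      exact Set.mem_iUnion.2 ⟨U, by
        change ¬ (y ∈ U ↔ P U)
        tauto⟩)
  have hV : P ((t.filter P).inf id) := Finset.inf_induction htop
    (fun U hU V hV => hinf U V hU hV) fun U hU => (Finset.mem_filter.1 hU).2
  have hW : ¬ P ((t.filter (¬ P ·)).sup id) := Finset.sup_induction (p := (¬ P ·)) hbot
    (fun U hU V hV h => (hsup U V h).elim hU hV) fun U hU => (Finset.mem_filter.1 hU).2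
  refine hW (hmono _ _ (fun y hy => ?_) hV)
  obtain ⟨U, hU⟩ := Set.mem_iUnion.1 (ht (Set.mem_univ y))
  obtain ⟨hUt, hU⟩ := Set.mem_iUnion.1 hU
  by_cases hP : P U
  · exact (hU (iff_of_true (Finset.inf_le (f := id) (Finset.mem_filter.2 ⟨hUt, hP⟩) hy) hP)).elim
  · have hyU : y ∈ U := by
      by_contra hy
      exact hU (iff_of_false hy hP)
    exact Finset.le_sup (f := id) (Finset.mem_filter.2 ⟨hUt, hP⟩) hyU

/-- A lattice homomorphism to the clopen upsets whose image separates the order is surjective. -/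
theorem surjective_of_separates {A : Type u} [HeytingAlgebra A]
    (S : BoundedLatticeHom A (ClopenUpperSet Y))
    (hS : ∀ p q : Y, ¬ p ≤ q → ∃ a, p ∈ S a ∧ q ∉ S a) : Function.Surjective S := by
  intro U
  -- For fixed `p`, the complements of the `S a` containing `p` cover the compact complement of `U`;
  -- a finite meet squeezes between `p` and `U`. A second finite cover, of `U` itself, then gives
  -- `U` as a join.
  have key : ∀ p : U, ∃ a, p.1 ∈ S a ∧ S a ≤ U := by
    rintro ⟨p, hp⟩
    obtain ⟨t, ht⟩ := U.isClopen.compl.isClosed.isCompact.elim_finite_subcover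
      (fun a : {a // p ∈ S a} => ((S a : ClopenUpperSet Y) : Set Y)ᶜ)
      (fun a => (S a).isClopen.compl.isOpen) (fun q hq => by
        obtain ⟨a, ha, hqa⟩ := hS p q fun h => hq (U.upper h hp)
        exact Set.mem_iUnion.2 ⟨⟨a, ha⟩, hqa⟩)
    refine ⟨t.inf Subtype.val, ?_, fun q hq => ?_⟩
    · refine Finset.inf_induction (p := fun a => p ∈ S a) ?_ ?_ fun a _ => a.2
      · rw [map_top]
        trivial
      · intro a ha b hb
        rw [map_inf]
        exact ⟨ha, hb⟩
    · by_contra hqU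
      obtain ⟨a, ha⟩ := Set.mem_iUnion.1 (ht hqU)
      obtain ⟨hat, ha⟩ := Set.mem_iUnion.1 ha
      exact ha (OrderHomClass.mono S (Finset.inf_le hat) hq)
  choose g hg hgU using key
  obtain ⟨t, ht⟩ := U.isClopen.isClosed.isCompact.elim_finite_subcover
    (fun p : U => (S (g p) : Set Y)) (fun p => (S (g p)).isClopen.isOpen)
    (fun p hp => Set.mem_iUnion.2 ⟨⟨p, hp⟩, hg _⟩)
  refine ⟨t.sup g, le_antisymm ?_ fun p hp => ?_⟩
  · refine Finset.sup_induction (p := fun a => S a ≤ U) ?_ ?_ fun p _ => hgU p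
    · rw [map_bot]
      exact bot_le
    · intro a ha b hb
      rw [map_sup]
      exact sup_le ha hb
  · obtain ⟨q, hq⟩ := Set.mem_iUnion.1 (ht hp)
    obtain ⟨hqt, hq⟩ := Set.mem_iUnion.1 hq
    exact OrderHomClass.mono S (Finset.le_sup hqt) hq

theorem eq_of_forall_mem_iff {p q : Y} (h : ∀ U : ClopenUpperSet Y, p ∈ U ↔ q ∈ U) : p = q := by
  refine le_antisymm ?_ ?_ <;> by_contra hle
  · obtain ⟨U, hc, hu, hp, hq⟩ := exists_isClopen_upper_of_not_le hle
    exact hq ((h ⟨⟨U, hc⟩, hu⟩).1 hp)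
  · obtain ⟨U, hc, hu, hp, hq⟩ := exists_isClopen_upper_of_not_le hle
    exact hq ((h ⟨⟨U, hc⟩, hu⟩).2 hp)

theorem le_of_forall_mem {p q : Y} (h : ∀ U : ClopenUpperSet Y, p ∈ U → q ∈ U) : p ≤ q := by
  by_contra hle
  obtain ⟨U, hc, hu, hp, hq⟩ := exists_isClopen_upper_of_not_le hle
  exact hq (h ⟨⟨U, hc⟩, hu⟩ hp)

end Compactness

/-! ### The dual functor is full and faithful -/

section FullyFaithful

theorem Total.mk_inj {X : Type u} [PartialOrder X] {F : X ⥤ Profinite.{u}} {x : X}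
    {ξ η : F.obj x} (h : (⟨x, ξ⟩ : Total F) = ⟨x, η⟩) : ξ = η :=
  eq_of_heq (Sigma.mk.inj h).2

/-- The clopen upset that meets the fibre over `x` in `C` and contains everything strictly
above that fibre. -/
def Total.extend {X : Type u} [PartialOrder X] {F : X ⥤ Profinite.{u}} {x : X}
    (C : Clopens (F.obj x)) : ClopenUpperSet (Total F) where
  carrier := {p | x ≤ p.1 ∧ ∀ h : p.1 ≤ x, F.map (homOfLE h) p.2 ∈ C}
  isClopen' := by
    refine Total.isClopen_iff.2 fun z => ?_
    by_cases hxz : x ≤ z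
    · by_cases hzx : z ≤ x
      · convert C.isClopen.preimage (F.map (homOfLE hzx)).hom.hom.continuous using 1
        ext ζ
        exact ⟨fun h => h.2 hzx, fun h => ⟨hxz, fun _ => h⟩⟩
      · convert isClopen_univ using 1
        ext ζ
        exact ⟨fun _ => trivial, fun _ => ⟨hxz, fun h => (hzx h).elim⟩⟩
    · convert isClopen_empty using 1
      ext ζ
      exact ⟨fun h => hxz h.1, fun h => h.elim⟩
  upper' := by
    rintro p q ⟨hpq, e⟩ ⟨hx, hp⟩
    refine ⟨hx.trans hpq, fun h => ?_⟩
    rw [← e, Total.map_map]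
    exact hp _

/-- Every clopen subset of a fibre is thus the trace of a clopen upset, so clopen upsets suffice to
test continuity on fibres. -/
theorem Total.mk_mem_extend {X : Type u} [PartialOrder X] {F : X ⥤ Profinite.{u}} {x : X}
    {C : Clopens (F.obj x)} {ξ : F.obj x} : (⟨x, ξ⟩ : Total F) ∈ Total.extend C ↔ ξ ∈ C := by
  have e : F.map (homOfLE (le_refl x)) ξ = ξ := by
    have : homOfLE (le_refl x) = 𝟙 x := rfl
    rw [this, F.map_id]
    rfl
  constructor
  · rintro ⟨_, h⟩
    have h' := h (le_refl x)
    change F.map (homOfLE (le_refl x)) ξ ∈ C at h'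
    rwa [e] at h'
  · refine fun h => ⟨le_rfl, fun _ => ?_⟩
    change F.map (homOfLE (le_refl x)) ξ ∈ C
    rwa [e]

variable {H : Type u} [HeytingAlgebra H] [Finite H]

theorem exists_dualHom_totalMap_eq {F G : EsakiaDual H ⥤ Profinite.{u}}
    (φ : HeytingHom (ClopenUpperSet (Total G)) (ClopenUpperSet (Total F)))
    (hφ : ∀ a : H, φ (dualHom (proj G) (reprHom H a)) = dualHom (proj F) (reprHom H a)) :
    ∃ γ : F ⟶ G, dualHom (totalMap γ) = φ := by
  have hpt : ∀ p : Total F, ∃ q : Total G, ∀ U : ClopenUpperSet (Total G), q ∈ U ↔ p ∈ φ U := by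
    intro p
    refine exists_forall_mem_iff (fun U => p ∈ φ U) ?_ ?_ ?_ ?_ ?_
    · intro U V hU hV
      rw [map_inf]
      exact ⟨hU, hV⟩
    · intro U V h
      rw [map_sup] at h
      exact h
    · exact fun U V h hU => OrderHomClass.mono φ h hU
    · rw [map_top]
      trivial
    · rw [map_bot]
      exact id
  choose f hf using hpt
  -- Compatibility with the maps from `H` forces `f` to preserve the base point.
  have hfst : ∀ p, (f p).1 = p.1 := by
    refine fun p => EsakiaDual.ext_mem fun a => ?_
    have h := hf p (dualHom (proj G) (reprHom H a))
    rw [hφ] at h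
    exact h
  have hfib : ∀ (x : EsakiaDual H) (ξ : F.obj x), ∃ η : G.obj x, f ⟨x, ξ⟩ = ⟨x, η⟩ := by
    intro x ξ
    have h := hfst ⟨x, ξ⟩
    rcases hq : f ⟨x, ξ⟩ with ⟨y, η⟩
    rw [hq] at h
    obtain rfl : y = x := h
    exact ⟨η, rfl⟩
  choose g hg using hfib
  have hcont : ∀ x, Continuous (g x) := by
    intro x
    refine (isTopologicalBasis_isClopen (X := G.obj x)).continuous_iff.2 fun C hC => ?_
    have h := (Total.isClopen_iff.1 (φ (Total.extend ⟨C, hC⟩)).isClopen x).isOpen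
    convert h using 1
    ext ξ
    refine Iff.trans ?_ (hf ⟨x, ξ⟩ (Total.extend ⟨C, hC⟩))
    rw [hg]
    exact (Total.mk_mem_extend (F := G) (C := ⟨C, hC⟩)).symm
  have hmono : Monotone f := fun p q hpq => le_of_forall_mem fun U hU =>
    (hf q U).2 ((φ U).upper hpq ((hf p U).1 hU))
  refine ⟨{ app := fun x => ConcreteCategory.ofHom ⟨g x, hcont x⟩, naturality := ?_ }, ?_⟩
  · intro x y h
    refine ConcreteCategory.hom_ext _ _ fun ξ => ?_
    -- The order of the total space encodes the transition maps, so monotonicity of `f` applied here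
    -- is the naturality square.
    have hle : LE.le (α := Total F) ⟨x, ξ⟩ ⟨y, F.map h ξ⟩ := ⟨leOfHom h, rfl⟩
    have hle' := hmono hle
    rw [hg, hg] at hle'
    obtain ⟨_, e⟩ := hle'
    exact e.symm
  · refine DFunLike.ext _ _ fun U => SetLike.ext fun p => ?_
    refine Iff.trans ?_ (hf p U)
    rcases p with ⟨x, ξ⟩
    rw [hg]
    exact Iff.rfl

instance : (dualFunctor H).Full where
  map_surjective {F G} φ := by
    obtain ⟨γ, hγ⟩ := exists_dualHom_totalMap_eq (F := G.unop) (G := F.unop) φ.right.hom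
      fun a => congrArg (fun k => HeytAlg.Hom.hom k a) (Under.w φ)
    exact ⟨γ.op, Under.UnderMorphism.ext (congrArg HeytAlg.ofHom hγ)⟩

instance : (dualFunctor H).Faithful where
  map_injective {F G} γ γ' h := by
    have hU : ∀ U : ClopenUpperSet (Total F.unop),
        dualHom (totalMap γ.unop) U = dualHom (totalMap γ'.unop) U := fun U =>
      congrArg (fun k => HeytAlg.Hom.hom (CommaMorphism.right k) U) h
    refine Quiver.Hom.unop_inj (NatTrans.ext (funext fun x => ?_))
    refine ConcreteCategory.hom_ext _ _ fun ξ => Total.mk_inj (F := F.unop) ?_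
    exact eq_of_forall_mem_iff (Y := Total F.unop) fun U => SetLike.ext_iff.1 (hU U) ⟨x, ξ⟩

end FullyFaithful

/-! ### The identities that characterize étale algebras -/

section FiberwiseSplit

theorem himp_inf_himp_sup_le {A : Type u} [HeytingAlgebra A] {a b u v : A} :
    (a ⊓ u ⇨ b) ⊓ (a ⇨ b ⊔ (u ⊔ v)) ≤ a ⇨ b ⊔ v := by
  rw [le_himp_iff]
  set w := (a ⊓ u ⇨ b) ⊓ (a ⇨ b ⊔ (u ⊔ v)) ⊓ a with hw
  have hwa : w ≤ a := inf_le_right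
  have h : w ≤ b ⊔ (u ⊔ v) := (inf_le_inf_right a inf_le_right).trans himp_inf_le
  have hu : w ⊓ u ≤ b := (le_inf ((inf_le_left.trans inf_le_left).trans inf_le_left)
    (inf_le_inf_right u hwa)).trans himp_inf_le
  rw [← inf_eq_left.2 h, inf_sup_left, inf_sup_left]
  exact sup_le (inf_le_right.trans le_sup_left)
    (sup_le (hu.trans le_sup_left) (inf_le_right.trans le_sup_right))

variable {H A : Type u} [HeytingAlgebra H] [HeytingAlgebra A]

/-- The identities saying that, for every prime filter `P` of `A` and every `y` above the image
of `P` in the dual of `H`, there is at most one prime filter above `P` lying over `y`. Here `a`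
and `b` are the elements of `H` representing `↑y` and the complement of `↓y`. -/
def IsFiberwiseSplit (c : HeytingHom H A) : Prop :=
  ∀ (y : EsakiaDual H) (a b : H), (∀ z : EsakiaDual H, a ∈ z.1 ↔ y ≤ z) →
    (∀ z : EsakiaDual H, b ∈ z.1 ↔ ¬ z ≤ y) →
    ∀ u : A, (c a ⊓ u ⇨ c b) ⊔ (c a ⇨ c b ⊔ u) = ⊤

/-- The fibre over `y` is the single point `y`. If `u ∈ y`, then `u` lies in all of `↑y`, so `a ≤
u`; otherwise no prime filter containing `u` is below `y`, so `u ≤ b`. -/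
theorem isFiberwiseSplit_id : IsFiberwiseSplit (HeytingHom.id H) := by
  intro y a b ha hb u
  refine top_le_iff.1 ?_
  by_cases hu : u ∈ y.1
  · refine le_sup_of_le_right (le_himp_iff.2 (EsakiaDual.le_iff_forall_mem.2 fun z hz => ?_))
    rw [top_inf_eq] at hz
    exact z.sup_mem_iff.2 (Or.inr ((ha z).1 hz hu))
  · refine le_sup_of_le_left (le_himp_iff.2 (EsakiaDual.le_iff_forall_mem.2 fun z hz => ?_))
    rw [top_inf_eq] at hz
    obtain ⟨-, hz⟩ := Order.PFilter.inf_mem_iff.1 hz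
    exact (hb z).2 fun hzy => hu (hzy hz)

theorem IsFiberwiseSplit.of_injective {B : Type u} [HeytingAlgebra B] {c : HeytingHom H A}
    (f : HeytingHom A B) (hf : Function.Injective f) (h : IsFiberwiseSplit (f.comp c)) :
    IsFiberwiseSplit c := by
  intro y a b ha hb u
  have := h y a b ha hb (f u)
  refine hf ?_
  simpa only [HeytingHom.comp_apply, map_sup, map_himp, map_inf, map_top] using this

theorem IsFiberwiseSplit.of_surjective {B : Type u} [HeytingAlgebra B] {c : HeytingHom H A}
    (f : HeytingHom A B) (hf : Function.Surjective f) (h : IsFiberwiseSplit c) :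
    IsFiberwiseSplit (f.comp c) := by
  intro y a b ha hb v
  obtain ⟨u, rfl⟩ := hf v
  have := congrArg f (h y a b ha hb u)
  simpa only [HeytingHom.comp_apply, map_sup, map_himp, map_inf, map_top] using this

/-- The splitting conditions are equations with constants from `H`, hence inherited by products,
subalgebras and homomorphic images. -/
theorem IsEtale.isFiberwiseSplit {A : HAlg H} (hA : IsEtale A) :
    IsFiberwiseSplit (A := A.right) A.hom.hom := by
  induction hA with
  | base => exact isFiberwiseSplit_id
  | prod A _ ih => exact fun y a b ha hb u => funext fun i => ih i y a b ha hb (u i)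
  | @sub A B f hf _ ih =>
    refine IsFiberwiseSplit.of_injective f.right.hom hf ?_
    rwa [← Under.w f] at ih
  | @image A B f hf _ ih =>
    rw [← Under.w f]
    exact ih.of_surjective f.right.hom hf

end FiberwiseSplit

/-! ### Fibres of the dual of an algebra over `H` -/

section Fiber

variable {H A : Type u} [HeytingAlgebra H] [HeytingAlgebra A] (c : HeytingHom H A)

/-- The characteristic functions of the prime filters of `A` lying over `y`. -/
def fiberSet (y : EsakiaDual H) : Set (A → Bool) :=
  {f | (∀ u v, f (u ⊓ v) = (f u && f v)) ∧ (∀ u v, f (u ⊔ v) = (f u || f v)) ∧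
    ∀ h : H, f (c h) = true ↔ h ∈ y.1}

theorem isClosed_fiberSet (y : EsakiaDual H) : IsClosed (fiberSet c y) := by
  classical
  -- Written as an equation with a constant, this condition, like the other two, cuts out a closed
  -- set.
  have h3 : ∀ (f : A → Bool) (h : H),
      (f (c h) = true ↔ h ∈ y.1) ↔ f (c h) = decide (h ∈ y.1) := by
    intro f h
    by_cases hy : h ∈ y.1 <;> simp [hy]
  simp only [fiberSet, h3, Set.ofPred_and, Set.ofPred_forall]
  have hand : Continuous fun p : Bool × Bool => p.1 && p.2 := continuous_of_discreteTopology
  have hor : Continuous fun p : Bool × Bool => p.1 || p.2 := continuous_of_discreteTopology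
  refine IsClosed.inter ?_ (IsClosed.inter ?_ ?_)
  · exact isClosed_iInter fun u => isClosed_iInter fun v => isClosed_eq (continuous_apply _)
      (hand.comp (f := fun f : A → Bool => (f u, f v)) (by fun_prop))
  · exact isClosed_iInter fun u => isClosed_iInter fun v => isClosed_eq (continuous_apply _)
      (hor.comp (f := fun f : A → Bool => (f u, f v)) (by fun_prop))
  · exact isClosed_iInter fun h => isClosed_eq (continuous_apply _) continuous_const

/-- The Stone space of prime filters of `A` lying over `y`. -/
abbrev Fiber (y : EsakiaDual H) : Type u := fiberSet c y

instance (y : EsakiaDual H) : CompactSpace (Fiber c y) :=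
  isCompact_iff_compactSpace.1 (isClosed_fiberSet c y).isCompact

variable {c}

namespace Fiber

variable {x y z : EsakiaDual H}

theorem inf_iff (f : Fiber c y) {u v : A} :
    f.1 (u ⊓ v) = true ↔ f.1 u = true ∧ f.1 v = true := by
  rw [f.2.1, Bool.and_eq_true]

theorem sup_iff (f : Fiber c y) {u v : A} :
    f.1 (u ⊔ v) = true ↔ f.1 u = true ∨ f.1 v = true := by
  rw [f.2.2.1, Bool.or_eq_true]

theorem map_iff (f : Fiber c y) {h : H} : f.1 (c h) = true ↔ h ∈ y.1 := f.2.2.2 h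

theorem mono (f : Fiber c y) {u v : A} (huv : u ≤ v) (hu : f.1 u = true) : f.1 v = true := by
  rw [← inf_eq_left.2 huv] at hu
  exact (f.inf_iff.1 hu).2

theorem top (f : Fiber c y) : f.1 ⊤ = true := by
  rw [← map_top c]
  exact f.map_iff.2 Order.PFilter.top_mem

theorem bot (f : Fiber c y) : ¬ f.1 ⊥ = true := by
  rw [← map_bot c]
  exact fun h => y.bot_notMem (f.map_iff.1 h)

theorem ext_iff' {f g : Fiber c y} : f = g ↔ ∀ u, f.1 u = true ↔ g.1 u = true := by
  refine ⟨fun h u => h ▸ Iff.rfl, fun h => Subtype.ext (funext fun u => ?_)⟩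
  exact Bool.eq_iff_iff.2 (h u)

variable {a b : H}

/-- The only prime filter over `y` that may contain the prime filter `f` over `x`. -/
theorem eq_of_le (hc : IsFiberwiseSplit c) (ha : ∀ z : EsakiaDual H, a ∈ z.1 ↔ y ≤ z)
    (hb : ∀ z : EsakiaDual H, b ∈ z.1 ↔ ¬ z ≤ y) (f : Fiber c x) (g : Fiber c y)
    (hfg : ∀ u, f.1 u = true → g.1 u = true) (u : A) :
    g.1 u = true ↔ f.1 (c a ⇨ c b ⊔ u) = true := by
  have hga : g.1 (c a) = true := g.map_iff.2 ((ha y).2 le_rfl)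
  have hgb : ¬ g.1 (c b) = true := fun h => (hb y).1 (g.map_iff.1 h) le_rfl
  constructor
  · intro hu
    have h := f.top
    rw [← hc y a b ha hb u, f.sup_iff] at h
    -- The first disjunct would pass from `f` to `g`, where `c a` and `u` would then force `c b`.
    refine h.resolve_left fun h => hgb ?_
    exact g.mono himp_inf_le (g.inf_iff.2 ⟨hfg _ h, g.inf_iff.2 ⟨hga, hu⟩⟩)
  · intro hu
    have h := g.mono himp_inf_le (g.inf_iff.2 ⟨hfg _ hu, hga⟩)
    exact (g.sup_iff.1 h).resolve_left hgb

/-- The formula that `eq_of_le` forces does define a point over `y`: meets are formal, joins use the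
splitting identity, and `x ≤ y` places the point over `y`. -/
theorem exists_le (hc : IsFiberwiseSplit c) (ha : ∀ z : EsakiaDual H, a ∈ z.1 ↔ y ≤ z)
    (hb : ∀ z : EsakiaDual H, b ∈ z.1 ↔ ¬ z ≤ y) (hxy : x ≤ y) (f : Fiber c x) :
    (fun u => f.1 (c a ⇨ c b ⊔ u)) ∈ fiberSet c y := by
  refine ⟨fun u v => ?_, fun u v => ?_, fun h => ?_⟩
  · beta_reduce
    rw [sup_inf_left, himp_inf_distrib, f.2.1]
  · rw [Bool.eq_iff_iff, Bool.or_eq_true]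
    constructor
    · intro h
      have ht := f.top
      rw [← hc y a b ha hb u, f.sup_iff] at ht
      rcases ht with ht | ht
      · refine Or.inr (f.mono ?_ (f.inf_iff.2 ⟨ht, h⟩))
        exact himp_inf_himp_sup_le
      · exact Or.inl ht
    · rintro (h | h)
      · exact f.mono (himp_le_himp_left (sup_le_sup_left le_sup_left _)) h
      · exact f.mono (himp_le_himp_left (sup_le_sup_left le_sup_right _)) h
  · beta_reduce
    rw [← map_sup, ← map_himp, f.map_iff, EsakiaDual.himp_mem_iff]
    constructor
    · intro hh
      have := hh y hxy ((ha y).2 le_rfl)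
      exact (y.sup_mem_iff.1 this).resolve_left fun h => (hb y).1 h le_rfl
    · intro hh z _ hz
      exact z.sup_mem_iff.2 (Or.inr ((ha z).1 hz hh))

theorem le_transition (f : Fiber c x) {u : A} (hu : f.1 u = true) :
    f.1 (c a ⇨ c b ⊔ u) = true :=
  f.mono (le_sup_right.trans le_himp) hu

/-- A prime filter of `A` separating `u` from `v` lies over its preimage under `c`, so the fibres
together separate elements of `A`. -/
theorem exists_notMem {u v : A} (huv : ¬ u ≤ v) :
    ∃ (y : EsakiaDual H) (f : Fiber c y), f.1 u = true ∧ ¬ f.1 v = true := by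
  classical
  obtain ⟨P, hu, hv⟩ := EsakiaDual.exists_mem_notMem huv
  refine ⟨EsakiaDual.mk (fun h => c h ∈ P.1) (fun h k => ?_) (fun h k => ?_) ?_ ?_,
    ⟨fun u => decide (u ∈ P.1), fun u v => ?_, fun u v => ?_, fun h => ?_⟩, ?_, ?_⟩
  · rw [map_inf]
    exact Order.PFilter.inf_mem_iff
  · rw [map_sup]
    exact P.sup_mem_iff.1
  · rw [map_top]
    exact Order.PFilter.top_mem
  · rw [map_bot]
    exact P.bot_notMem
  · rw [← Bool.decide_and]
    exact decide_eq_decide.2 Order.PFilter.inf_mem_iff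
  · rw [← Bool.decide_or]
    exact decide_eq_decide.2 P.sup_mem_iff
  · rw [decide_eq_true_iff]
    exact Iff.rfl
  · exact decide_eq_true hu
  · simpa using hv

end Fiber

end Fiber

/-! ### The copresheaf of fibres and the representation of `A` -/

section Copresheaf

variable {H A : Type u} [HeytingAlgebra H] [Finite H] [HeytingAlgebra A] {c : HeytingHom H A}

/-- Characterizing `t` by inclusion of filters hides the choice of `a` and `b` and reduces
functoriality to reflexivity and transitivity. Continuity holds because each coordinate of `t f` is
a coordinate of `f`. -/
theorem Fiber.exists_transition (hc : IsFiberwiseSplit c) {x y : EsakiaDual H} (hxy : x ≤ y) :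
    ∃ t : C(Fiber c x, Fiber c y), ∀ f : Fiber c x, ∀ g : Fiber c y,
      t f = g ↔ ∀ u, f.1 u = true → g.1 u = true := by
  obtain ⟨a, ha⟩ := y.exists_mem_iff_le
  obtain ⟨b, hb⟩ := y.exists_mem_iff_not_le
  refine ⟨⟨fun f => ⟨_, f.exists_le hc ha hb hxy⟩, ?_⟩, fun f g => ⟨?_, fun h => ?_⟩⟩
  · exact Continuous.subtype_mk
      (continuous_pi fun u => (continuous_apply (c a ⇨ c b ⊔ u)).comp
        (continuous_subtype_val (p := (· ∈ fiberSet c x)))) _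
  · rintro rfl u hu
    exact f.le_transition hu
  · exact Fiber.ext_iff'.2 fun u => (Fiber.eq_of_le hc ha hb f g h u).symm

/-- The transition map of the fibres of the dual of an algebra satisfying the splitting
identities. -/
noncomputable def Fiber.transition (hc : IsFiberwiseSplit c) {x y : EsakiaDual H} (hxy : x ≤ y) :
    C(Fiber c x, Fiber c y) :=
  (Fiber.exists_transition hc hxy).choose

theorem Fiber.transition_eq_iff (hc : IsFiberwiseSplit c) {x y : EsakiaDual H} (hxy : x ≤ y)
    {f : Fiber c x} {g : Fiber c y} :
    Fiber.transition hc hxy f = g ↔ ∀ u, f.1 u = true → g.1 u = true :=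
  (Fiber.exists_transition hc hxy).choose_spec f g

/-- The copresheaf of fibres of the dual of an algebra over `H`. -/
noncomputable def fiberFunctor (hc : IsFiberwiseSplit c) : EsakiaDual H ⥤ Profinite.{u} where
  obj y := Profinite.of (Fiber c y)
  map h := ConcreteCategory.ofHom (Fiber.transition hc (leOfHom h))
  map_id _ := ConcreteCategory.hom_ext _ _ fun _ =>
    (Fiber.transition_eq_iff hc le_rfl).2 fun _ => id
  map_comp h k := ConcreteCategory.hom_ext _ _ fun _ =>
    (Fiber.transition_eq_iff hc ((leOfHom h).trans (leOfHom k))).2 fun u hu =>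
      (Fiber.transition_eq_iff hc (leOfHom k)).1 rfl u
        ((Fiber.transition_eq_iff hc (leOfHom h)).1 rfl u hu)

theorem fiberFunctor_le_iff (hc : IsFiberwiseSplit c) {p q : Total (fiberFunctor hc)} :
    p ≤ q ↔ ∀ u : A, (p.2 : Fiber c p.1).1 u = true → (q.2 : Fiber c q.1).1 u = true := by
  constructor
  · rintro ⟨h, e⟩
    exact (Fiber.transition_eq_iff hc h).1 e
  · intro h
    have hle : p.1 ≤ q.1 := fun a ha => (q.2 : Fiber c q.1).map_iff.1
      (h (c a) ((p.2 : Fiber c p.1).map_iff.2 ha))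
    exact ⟨hle, (Fiber.transition_eq_iff hc hle).2 h⟩

/-- The representation of an algebra by clopen upsets of the total space of its fibres. -/
noncomputable def fiberRepr (hc : IsFiberwiseSplit c) :
    BoundedLatticeHom A (ClopenUpperSet (Total (fiberFunctor hc))) where
  toFun u :=
    { carrier := {p | (p.2 : Fiber c p.1).1 u = true}
      isClopen' := Total.isClopen_iff.2 fun x =>
        (isClopen_discrete {true}).preimage
          ((continuous_apply u).comp (continuous_subtype_val (p := (· ∈ fiberSet c x))))
      upper' := fun _ _ hpq hp => (fiberFunctor_le_iff hc).1 hpq u hp }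
  map_sup' _ _ := SetLike.ext fun p => (p.2 : Fiber c p.1).sup_iff
  map_inf' _ _ := SetLike.ext fun p => (p.2 : Fiber c p.1).inf_iff
  map_top' := SetLike.ext fun p => iff_of_true (p.2 : Fiber c p.1).top trivial
  map_bot' := SetLike.ext fun p => iff_of_false (p.2 : Fiber c p.1).bot id

theorem fiberRepr_le_iff (hc : IsFiberwiseSplit c) {u v : A} :
    fiberRepr hc u ≤ fiberRepr hc v ↔ u ≤ v := by
  refine ⟨fun h => ?_, fun h => OrderHomClass.mono _ h⟩
  by_contra huv
  obtain ⟨y, f, hu, hv⟩ := Fiber.exists_notMem (c := c) huv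
  exact hv (h (show (⟨y, f⟩ : Total (fiberFunctor hc)) ∈ fiberRepr hc u from hu))

/-- The order on the total space is inclusion of prime filters, so any failure of `p ≤ q` is
witnessed by an element of `A`. -/
theorem fiberRepr_surjective (hc : IsFiberwiseSplit c) : Function.Surjective (fiberRepr hc) := by
  refine surjective_of_separates _ fun p q hpq => ?_
  rw [fiberFunctor_le_iff] at hpq
  push Not at hpq
  obtain ⟨u, hp, hq⟩ := hpq
  exact ⟨u, hp, fun h => hq h⟩

/-- The representation of an algebra satisfying the splitting identities is an isomorphism. -/
noncomputable def fiberOrderIso (hc : IsFiberwiseSplit c) :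
    A ≃o ClopenUpperSet (Total (fiberFunctor hc)) :=
  RelIso.ofSurjective (OrderEmbedding.ofMapLEIff (fiberRepr hc) fun _ _ => fiberRepr_le_iff hc)
    (fiberRepr_surjective hc)

theorem IsFiberwiseSplit.nonempty_iso {A : HAlg H}
    (hA : IsFiberwiseSplit (A := A.right) A.hom.hom) :
    Nonempty ((dualFunctor H).obj (op (fiberFunctor hA)) ≅ A) := by
  have h : ∀ a : H, fiberOrderIso hA (A.hom.hom a) =
      dualHom (proj (fiberFunctor hA)) (reprHom H a) := fun a =>
    SetLike.ext fun p => (p.2 : Fiber A.hom.hom p.1).map_iff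
  -- An order isomorphism automatically preserves implication, so a representation by lattice
  -- operations was enough.
  exact ⟨(Under.isoMk (f := A) (g := (dualFunctor H).obj (op (fiberFunctor hA)))
    (HeytAlg.Iso.mk (fiberOrderIso hA)) (ConcreteCategory.hom_ext _ _ h)).symm⟩

end Copresheaf

/-! ### The dual equivalence -/

section Duality

variable (H : Type u) [HeytingAlgebra H] [Finite H]

/-- The functor `F ↦ H(F)` with values in étale `H`-algebras. -/
def etaleDualFunctor : (EsakiaDual H ⥤ Profinite.{u})ᵒᵖ ⥤ EtaleAlg H :=
  (IsEtale (H := H)).lift (dualFunctor H) isEtale_dualFunctor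

instance : (etaleDualFunctor H).Full :=
  inferInstanceAs ((IsEtale (H := H)).lift (dualFunctor H) isEtale_dualFunctor).Full

instance : (etaleDualFunctor H).Faithful :=
  inferInstanceAs ((IsEtale (H := H)).lift (dualFunctor H) isEtale_dualFunctor).Faithful

instance : (etaleDualFunctor H).EssSurj where
  mem_essImage A :=
    let ⟨i⟩ := A.property.isFiberwiseSplit.nonempty_iso
    ⟨op (fiberFunctor A.property.isFiberwiseSplit), ⟨(IsEtale (H := H)).isoMk i⟩⟩

instance : (etaleDualFunctor H).IsEquivalence where

end Duality

end EtaleHeyting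

theorem mainTheorem1 (H : Type u) [HeytingAlgebra H] [Finite H] :
    (∃ e : (EsakiaDual H ⥤ Profinite.{u})ᵒᵖ ≌ EtaleAlg H,
      Nonempty (e.functor ⋙ (IsEtale (H := H)).ι ≅ dualFunctor H)) ∧
    (∀ F : EsakiaDual H ⥤ Profinite.{u},
      ∃ m : (dualFunctor H).obj (op F) ⟶ HAlg.pi fun p : Total F => upIci p.1,
        Function.Injective m.right) ∧
    (∀ x : EsakiaDual H, ∃ q : HAlg.of (HeytingHom.id H) ⟶ upIci x, Function.Surjective q.right) :=
  ⟨⟨(etaleDualFunctor H).asEquivalence,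
      ⟨(IsEtale (H := H)).liftCompιIso (dualFunctor H) isEtale_dualFunctor⟩⟩,
    exists_injective_dualFunctor, exists_surjective_upIci⟩
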